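/- Let $\mathbb S_2\subset\mathbb R^3$ be the unit sphere with surface area measure $\Omega$ (total mass $4\pi$), and let $$Y_\ell^m(\vartheta,\varphi)=(-1)^m\sqrt{\frac{2\ell+1}{4\pi}\frac{(\ell-m)!}{(\ell+m)!}}\;P_\ell^m(\cos\vartheta)\,e^{im\varphi},\qquad \ell=0,1,2,\dots,\quad m=-\ell,\dots,\ell,$$ be the orthonormal complex spherical harmonics in terms of co-latitude $\vartheta$ and longitude $\varphi$. Here $P_\ell(x)=\frac1{2^\ell\ell!}\frac{d^\ell}{dx^\ell}(x^2-1)^\ell$, $P_\ell^m(x)=(1-x^2)^{m/2}\frac{d^m}{dx^m}P_\ell(x)$ for $m\ge0$, and $P_\ell^{-m}=(-1)^m\frac{(\ell-m)!}{(\ell+m)!}P_\ell^m$. Let $\underline{\widetilde x}_1,\underline{\widetilde x}_2,\dots$ be independent random points of $\mathbb S_2$, identically distributed with a (measurable) probability density $f$ with respect to $\Omega$. Put $$a_\ell^m=\int_{\mathbb S_2} f\,\overline{Y_\ell^m}\,d\Omega,\qquad \widehat{a_\ell^m}=\frac1n\sum_{k=1}^n\overline{Y_\ell^m(\underline{\widetilde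 x}_k)},$$ and let $\widehat{\underline A_L}(n)$ be the vector of all $\widehat{a_\ell^m}$ with $1\le\ell\le L$, $-\ell\le m\le\ell$. **Theorem.** Suppose that the hypothesis of uniformity $H_0$ holds: $a_\ell^m=0$ for all $\ell\ne0$ and all $m=-\ell,\dots,\ell$. Then for every integer $L\ge1$ the statistic $$4\pi n\,\bigl\|\widehat{\underline A_L}(n)\bigr\|^2=4\pi n\sum_{\ell=1}^{L}\sum_{m=-\ell}^{\ell}\bigl|\widehat{a_\ell^m}\bigr|^2$$ converges in distribution, as $n\to\infty$, to the $\chi^2$ distribution with $L(L+2)$ degrees of freedom. For $L=1$ the statistic is that of the Rayleigh test of uniformity on the sphere: for every $n$ (and every sample), $4\pi n\|\widehat{\underline A_1}(n)\|^2=3n\|\bar x\|^2$, where $\bar x=\frac1n\sum_{k=1}^n\underline{\widetilde x}_k\in\mathbb R^3$. -/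

import Mathlib

open MeasureTheory ProbabilityTheory

noncomputable section

namespace SphericalUniformity

/-- Three-dimensional Euclidean space. -/
abbrev E3 : Type := EuclideanSpace ℝ (Fin 3)

/-- The unit sphere `𝕊₂` of `ℝ³`. -/
abbrev S2 : Type := Metric.sphere (0 : E3) 1

/-- The surface area measure `Ω` on the unit sphere (total mass `4π`). -/
def surfaceMeasure : Measure S2 := (volume : Measure E3).toSphere

/-- The co-latitude `ϑ ∈ [0, π]` of a point of the sphere, so that `x₂ = cos ϑ`. -/
def colatitude (x : S2) : ℝ := Real.arccos ((x : E3) 2)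

/-- The longitude `φ` of a point of the sphere, so that `(x₀, x₁) = sin ϑ • (cos φ, sin φ)`.
It is the representative modulo `2π` in `(-π, π]`, and is `0` at the two poles; longitudes enter
below only through `exp (i m φ)` with `m` an integer. -/
def longitude (x : S2) : ℝ := Complex.arg ⟨(x : E3) 0, (x : E3) 1⟩

/-- The Legendre polynomial `P_ℓ`, by Rodrigues' formula
`P_ℓ = (1 / (2 ^ ℓ ℓ!)) d^ℓ/dx^ℓ (x² - 1) ^ ℓ`. -/
def legendre (l : ℕ) : Polynomial ℝ :=
  Polynomial.C (1 / ((2 : ℝ) ^ l * (l.factorial : ℝ))) *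
    Polynomial.derivative^[l] ((Polynomial.X ^ 2 - 1) ^ l)

/-- The associated Legendre function `P_ℓ^m` of integer order `m`, on `[-1, 1]`, normalized without
the factor `(-1) ^ m`: for `m ≥ 0` it is `(1 - x²) ^ (m / 2) d^m/dx^m P_ℓ(x)`, and for negative
order `P_ℓ^{-m} = (-1) ^ m ((ℓ - m)! / (ℓ + m)!) P_ℓ^m`. -/
def assocLegendre (l : ℕ) : ℤ → ℝ → ℝ
  | Int.ofNat m, x => √(1 - x ^ 2) ^ m * (Polynomial.derivative^[m] (legendre l)).eval x
  | Int.negSucc k, x =>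
      (-1) ^ (k + 1) * (((l - (k + 1)).factorial : ℝ) / ((l + (k + 1)).factorial : ℝ)) *
        (√(1 - x ^ 2) ^ (k + 1) * (Polynomial.derivative^[k + 1] (legendre l)).eval x)

/-- The fully normalized complex spherical harmonic `Y_ℓ^m(ϑ, φ)` of degree `ℓ` and order
`m ∈ {-ℓ, …, ℓ}`, in angular coordinates. -/
def sphericalHarmonicAngles (l : ℕ) (m : ℤ) (θ φ : ℝ) : ℂ :=
  (((-1 : ℝ) ^ m *
      √((2 * (l : ℝ) + 1) / (4 * Real.pi) *
        ((((l : ℤ) - m).toNat.factorial : ℝ) / (((l : ℤ) + m).toNat.factorial : ℝ))) *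
      assocLegendre l m (Real.cos θ) : ℝ) : ℂ) *
    Complex.exp (Complex.I * (m : ℂ) * (φ : ℂ))

/-- The spherical harmonic `Y_ℓ^m` as a function on the sphere. -/
def sphericalHarmonic (l : ℕ) (m : ℤ) (x : S2) : ℂ :=
  sphericalHarmonicAngles l m (colatitude x) (longitude x)

/-- The coefficient `a_ℓ^m = ∫ f (Y_ℓ^m)^* dΩ` of a function `f` on the sphere. -/
def harmonicCoeff (f : S2 → ℝ) (l : ℕ) (m : ℤ) : ℂ :=
  ∫ x, (f x : ℂ) * star (sphericalHarmonic l m x) ∂surfaceMeasure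

/-- The null hypothesis `H₀`: `a_ℓ^m = 0` for all `ℓ ≠ 0` and all orders `m = -ℓ, …, ℓ`. -/
def NullHypothesis (f : S2 → ℝ) : Prop :=
  ∀ l : ℕ, l ≠ 0 → ∀ m ∈ Finset.Icc (-(l : ℤ)) (l : ℤ), harmonicCoeff f l m = 0

/-- The estimator `(1 / n) ∑_{k < n} Y_ℓ^m(x_k)^*` of `a_ℓ^m` from the first `n` observations. -/
def estCoeff (x : ℕ → S2) (n : ℕ) (l : ℕ) (m : ℤ) : ℂ :=
  (1 / (n : ℂ)) * ∑ k ∈ Finset.range n, star (sphericalHarmonic l m (x k))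

/-- The pairs `(ℓ, m)` with `1 ≤ ℓ ≤ L` and `-ℓ ≤ m ≤ ℓ`. -/
def harmonicIndex (L : ℕ) : Finset (Σ _ : ℕ, ℤ) :=
  (Finset.Icc 1 L).sigma fun l => Finset.Icc (-(l : ℤ)) (l : ℤ)

/-- The vector `Â_L(n)` of all the estimated coefficients of degrees `1, …, L`. -/
def estVector (L : ℕ) (x : ℕ → S2) (n : ℕ) : EuclideanSpace ℂ (harmonicIndex L) :=
  WithLp.toLp 2 fun p => estCoeff x n p.1.1 p.1.2

/-- The test statistic `4 π n ‖Â_L(n)‖²`. -/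
def uniformityStatistic (L : ℕ) (x : ℕ → S2) (n : ℕ) : ℝ :=
  4 * Real.pi * n * ‖estVector L x n‖ ^ 2

/-- The statistic `3 n ‖x̄‖²` of the Rayleigh test of uniformity on the sphere, where `x̄` is the
sample mean in `ℝ³` of the first `n` observations. -/
def rayleighStatistic (x : ℕ → S2) (n : ℕ) : ℝ :=
  3 * n * ‖(1 / (n : ℝ)) • ∑ k ∈ Finset.range n, (x k : E3)‖ ^ 2

/-- The `χ²` distribution with `d` degrees of freedom: the law of the sum of the squares of `d`
independent standard normal variables. -/
def chiSquared (d : ℕ) : Measure ℝ :=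
  (Measure.pi fun _ : Fin d => gaussianReal 0 1).map fun z => ∑ i, z i ^ 2

instance instIsProbabilityMeasureChiSquared (d : ℕ) : IsProbabilityMeasure (chiSquared d) :=
  Measure.isProbabilityMeasure_map
    (Measurable.aemeasurable (by fun_prop))

end SphericalUniformity

end

/-! In the coordinates `w = x₀ + i x₁` and `x₂`, each `Y_ℓ^m` is a constant times `w^m` or a power
of `w̄`, times a polynomial in `x₂` (`sphericalHarmonic_eq`). Conversely the harmonics span all
polynomial functions on the sphere, so `H₀` forces every polynomial moment of the sample law to be
that of the uniform law (`integral_monomialFun_of_nullHypothesis`). Products of two harmonics are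
polynomials, so both the means and the covariances of the harmonics under the law of the sample are
the uniform ones, given by orthonormality (`integral_sphericalHarmonic_mul_star`).

The complex coefficients are turned into real ones by `√(4π) (Re Y_ℓ^m + Im Y_ℓ^m)`. Since `(Re s +
Im s)² = |s|² + Im s²` and `Im s²` is odd in `m`, the statistic is exactly `‖n^{-1/2} ∑
casVector(X_k)‖²` (`uniformityStatistic_eq_norm_sq`). Under `H₀` the summands are centred with
identity covariance (`integral_casHarmonic_mul`), in dimension `∑ (2ℓ + 1) = L(L + 2)`. The central
limit theorem and continuity of the squared norm give the `χ²` limit.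

Orthonormality rests on two computations: Legendre's differential equation gives the integrals over
`[-1, 1]`, and a Gaussian integral evaluated in polar and in cylindrical coordinates gives those
over the sphere. -/

namespace SphericalUniformity

/-! ### Legendre polynomials: differential equation, orthogonality, norms. -/

open Polynomial in
-- With `y = (X² - 1)^l` one has `(X² - 1) y' = 2 l X y`; differentiating `j + 1` times gives the
-- identity. Taking `j = l + m` yields the equation for the `m`-th derivative of `P_l`.
theorem iterate_derivative_sq_sub_one_pow (l j : ℕ) :
    (X ^ 2 - 1 : ℝ[X]) * derivative^[j + 2] ((X ^ 2 - 1) ^ l) +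
      2 * ((j : ℝ[X]) + 1 - (l : ℝ[X])) * X * derivative^[j + 1] ((X ^ 2 - 1) ^ l) =
      ((j : ℝ[X]) + 1) * (2 * (l : ℝ[X]) - (j : ℝ[X])) * derivative^[j] ((X ^ 2 - 1) ^ l) := by
  induction j with
  | zero =>
    have h : (X ^ 2 - 1 : ℝ[X]) * derivative ((X ^ 2 - 1) ^ l) = 2 * (l : ℝ[X]) * X * (X ^ 2 - 1) ^ l := by
      rcases l with _ | l
      · simp
      · simp [derivative_pow]
        rw [show (C 2 : ℝ[X]) = 2 from rfl]
        ring
    have h' := congrArg derivative h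
    simp [derivative_mul] at h'
    simp only [zero_add, Function.iterate_succ_apply', Function.iterate_zero_apply]
    push_cast
    linear_combination h'
  | succ j ih =>
    have h' := congrArg derivative ih
    simp [derivative_mul, Function.iterate_succ_apply'] at h'
    simp only [Function.iterate_succ_apply']
    push_cast
    linear_combination h'

/-- The `m`-th derivative of the Legendre polynomial of degree `l`. -/
noncomputable abbrev legendreDeriv (l m : ℕ) : Polynomial ℝ :=
  Polynomial.derivative^[m] (legendre l)

open Polynomial in
theorem legendreDeriv_eq (l m : ℕ) :
    legendreDeriv l m = C (1 / ((2 : ℝ) ^ l * (l.factorial : ℝ))) *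
      derivative^[l + m] ((X ^ 2 - 1) ^ l) := by
  rw [legendreDeriv, legendre, iterate_derivative_C_mul, ← Function.iterate_add_apply, add_comm m l]

open Polynomial in
theorem legendreDeriv_succ (l m : ℕ) :
    legendreDeriv l (m + 1) = derivative (legendreDeriv l m) := by
  rw [legendreDeriv, Function.iterate_succ_apply']

open Polynomial in
/-- The differential equation of the associated Legendre functions. -/
theorem legendreDeriv_ode (l m : ℕ) :
    (X ^ 2 - 1 : ℝ[X]) * legendreDeriv l (m + 2) + 2 * ((m : ℝ[X]) + 1) * X * legendreDeriv l (m + 1) =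
      ((l : ℝ[X]) + (m : ℝ[X]) + 1) * ((l : ℝ[X]) - (m : ℝ[X])) * legendreDeriv l m := by
  have h := iterate_derivative_sq_sub_one_pow l (l + m)
  simp only [legendreDeriv_eq]
  rw [show l + (m + 2) = l + m + 2 by ring, show l + (m + 1) = l + m + 1 by ring]
  push_cast at h
  linear_combination C (1 / ((2 : ℝ) ^ l * (l.factorial : ℝ))) * h

/-- The integral of a polynomial over `[-1, 1]`. -/
noncomputable def polyInt : Polynomial ℝ →ₗ[ℝ] ℝ where
  toFun p := ∫ x in (-1 : ℝ)..1, p.eval x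
  map_add' p q := by
    simp only [Polynomial.eval_add]
    exact intervalIntegral.integral_add (p.continuous.intervalIntegrable _ _)
      (q.continuous.intervalIntegrable _ _)
  map_smul' c p := by simp

open Polynomial in
theorem polyInt_derivative (p : ℝ[X]) : polyInt (derivative p) = p.eval 1 - p.eval (-1) :=
  intervalIntegral.integral_eq_sub_of_hasDerivAt (fun x _ => p.hasDerivAt x)
    ((derivative p).continuous.intervalIntegrable _ _)

open Polynomial in
theorem polyInt_derivative_mul (p q : ℝ[X]) (h1 : p.eval 1 = 0) (h2 : p.eval (-1) = 0) :
    polyInt (derivative p * q) = - polyInt (p * derivative q) := by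
  have h := polyInt_derivative (p * q)
  rw [derivative_mul, map_add] at h
  simp [h1, h2] at h
  linarith

open Polynomial in
theorem polyInt_X_pow (k : ℕ) :
    polyInt (X ^ k) = (1 - (-1) ^ (k + 1)) / (k + 1) := by
  simp [polyInt, integral_pow]

open Polynomial in
theorem polyInt_C_mul (c : ℝ) (p : ℝ[X]) : polyInt (C c * p) = c * polyInt p := by
  rw [← smul_eq_C_mul, map_smul, smul_eq_mul]

/-- The weighted inner product `∫ (1 - x²)^m P_l^(m) P_k^(m)` over `[-1, 1]`. -/
noncomputable def legendreInner (l k m : ℕ) : ℝ :=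
  polyInt ((1 - Polynomial.X ^ 2) ^ m * legendreDeriv l m * legendreDeriv k m)

theorem legendreInner_comm (l k m : ℕ) : legendreInner l k m = legendreInner k l m := by
  rw [legendreInner, legendreInner, mul_right_comm]

open Polynomial in
-- Integration by parts removes one derivative from `P_k^(m+1)`; the factor `(1 - X²)^(m+1)` kills
-- the boundary terms. The differential equation in Sturm–Liouville form then evaluates the
-- derivative of `(1 - X²)^(m+1) P_l^(m+1)`.
theorem legendreInner_succ (l k m : ℕ) :
    legendreInner l k (m + 1) = ((l : ℝ) + m + 1) * (l - m) * legendreInner l k m := by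
  have h := polyInt_derivative_mul ((1 - X ^ 2) ^ (m + 1) * legendreDeriv l (m + 1))
    (legendreDeriv k m) (by simp) (by simp)
  rw [← legendreDeriv_succ] at h
  rw [legendreInner, ← neg_inj, ← h, legendreInner, ← neg_mul, ← polyInt_C_mul]
  congr 1
  rw [derivative_mul, ← legendreDeriv_succ, derivative_pow]
  have h2 := legendreDeriv_ode l m
  simp
  linear_combination (- (1 - X ^ 2) ^ m * legendreDeriv k m) * h2

/-- By symmetry, raising the order from 0 to 1 multiplies by both `l(l + 1)` and `k(k + 1)`, which
differ by `(l - k)(l + k + 1) ≠ 0`. -/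
theorem legendreInner_zero_of_ne {l k : ℕ} (h : l ≠ k) : legendreInner l k 0 = 0 := by
  have h1 := legendreInner_succ l k 0
  have h2 := legendreInner_succ k l 0
  rw [legendreInner_comm k l, legendreInner_comm k l] at h2
  have h3 : ((l : ℝ) - k) * (l + k + 1) * legendreInner l k 0 = 0 := by
    push_cast at h1 h2
    linear_combination h2 - h1
  have h4 : (l : ℝ) - k ≠ 0 := sub_ne_zero.2 (by exact_mod_cast h)
  have h5 : (l : ℝ) + k + 1 ≠ 0 := by positivity
  simpa [h4, h5] using h3

theorem legendreInner_of_ne {l k : ℕ} (h : l ≠ k) (m : ℕ) : legendreInner l k m = 0 := by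
  induction m with
  | zero => exact legendreInner_zero_of_ne h
  | succ m ih => rw [legendreInner_succ, ih, mul_zero]

theorem legendreInner_eq_mul_zero {l m : ℕ} (k : ℕ) (hm : m ≤ l) :
    ((l - m).factorial : ℝ) * legendreInner l k m = (l + m).factorial * legendreInner l k 0 := by
  induction m with
  | zero => simp
  | succ m ih =>
    have ih := ih (by omega)
    rw [legendreInner_succ]
    rw [show l - m = (l - (m + 1)) + 1 by omega] at ih
    rw [← add_assoc, Nat.factorial_succ (l + m)]
    rw [Nat.factorial_succ] at ih
    push_cast [Nat.cast_sub hm] at ih ⊢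
    linear_combination (l + m + 1 : ℝ) * ih

open Polynomial in
-- Integrating by parts against `X` gives the recursion `(2l + 3) I_{l+1} = (2l + 2) I_l` of this
-- beta integral.
theorem polyInt_one_sub_sq_pow (l : ℕ) :
    polyInt ((1 - X ^ 2) ^ l) * (2 * l + 1).factorial = 2 * (2 ^ l * l.factorial) ^ 2 := by
  induction l with
  | zero =>
    have h := polyInt_X_pow 0
    norm_num at h ⊢
    exact h
  | succ l ih =>
    have h := polyInt_derivative_mul ((1 - X ^ 2) ^ (l + 1)) X (by simp) (by simp)
    have e : derivative ((1 - X ^ 2) ^ (l + 1) : ℝ[X]) * X =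
        C (2 * ((l : ℝ) + 1)) * (1 - X ^ 2) ^ (l + 1) - C (2 * ((l : ℝ) + 1)) * (1 - X ^ 2) ^ l := by
      rw [derivative_pow]
      simp only [map_mul, map_add, map_natCast, map_ofNat, map_one, derivative_sub, derivative_one,
        derivative_X_pow]
      push_cast
      simp
      ring
    rw [e, map_sub, polyInt_C_mul, polyInt_C_mul, derivative_X, mul_one] at h
    rw [show 2 * (l + 1) + 1 = 2 * l + 1 + 1 + 1 by ring, Nat.factorial_succ, Nat.factorial_succ,
      Nat.factorial_succ l]
    push_cast
    linear_combination (2 * l + 1 + 1 : ℝ) * (2 * l + 1).factorial * h +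
      (2 * l + 2 : ℝ) ^ 2 * ih

open Polynomial in
theorem natDegree_sq_sub_one_pow (l : ℕ) : ((X ^ 2 - 1 : ℝ[X]) ^ l).natDegree = 2 * l := by
  rw [natDegree_pow, show (X ^ 2 - 1 : ℝ[X]) = X ^ 2 - C 1 by simp, natDegree_X_pow_sub_C, mul_comm]

open Polynomial in
theorem monic_sq_sub_one_pow (l : ℕ) : ((X ^ 2 - 1 : ℝ[X]) ^ l).Monic := by
  refine Monic.pow ?_ l
  rw [show (X ^ 2 - 1 : ℝ[X]) = X ^ 2 - C 1 by simp]
  exact monic_X_pow_sub_C _ two_ne_zero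

open Polynomial in
theorem coeff_legendreDeriv {l m : ℕ} (hm : m ≤ l) :
    (legendreDeriv l m).coeff (l - m) =
      1 / ((2 : ℝ) ^ l * l.factorial) * ((2 * l).descFactorial (l + m)) := by
  rw [legendreDeriv_eq, coeff_C_mul, coeff_iterate_derivative, show l - m + (l + m) = 2 * l by omega,
    ← natDegree_sq_sub_one_pow l, (monic_sq_sub_one_pow l).coeff_natDegree]
  simp

open Polynomial in
-- The exact degree matters: for fixed `m` it supplies one polynomial of each degree, hence a
-- spanning family.
theorem degree_legendreDeriv {l m : ℕ} (hm : m ≤ l) :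
    (legendreDeriv l m).degree = ((l - m : ℕ) : WithBot ℕ) := by
  have h0 : (legendreDeriv l m).coeff (l - m) ≠ 0 := by
    rw [coeff_legendreDeriv hm]
    have : (2 * l).descFactorial (l + m) ≠ 0 := by
      rw [Ne, Nat.descFactorial_eq_zero_iff_lt]; omega
    positivity
  refine le_antisymm ?_ (le_degree_of_ne_zero h0)
  rw [degree_le_iff_coeff_zero]
  intro k hk
  rw [legendreDeriv_eq, coeff_C_mul, coeff_iterate_derivative, coeff_eq_zero_of_natDegree_lt]
  · simp
  · rw [natDegree_sq_sub_one_pow]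
    have : l - m < k := by exact_mod_cast hk
    omega

open Polynomial in
theorem legendreInner_self_zero (l : ℕ) : legendreInner l l 0 = 2 / (2 * l + 1) := by
  -- The order is raised all the way to `m = l`, where the derivative of `P_l` is constant and only
  -- the beta integral remains.
  have h := legendreInner_eq_mul_zero (l := l) l le_rfl
  have hc : legendreDeriv l l = C (1 / ((2 : ℝ) ^ l * l.factorial) * (2 * l).factorial) := by
    have h1 := eq_C_of_degree_le_zero (p := legendreDeriv l l)
      (by rw [degree_legendreDeriv le_rfl]; simp)
    have h2 := coeff_legendreDeriv (l := l) le_rfl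
    rw [Nat.sub_self, ← two_mul, Nat.descFactorial_self] at h2
    rw [h1, h2]
  have hB := polyInt_one_sub_sq_pow l
  rw [legendreInner, hc, mul_assoc, ← C_mul, mul_comm _ (C _), polyInt_C_mul, ← two_mul,
    Nat.sub_self] at h
  rw [Nat.factorial_succ] at hB
  have p1 : ((2 * l).factorial : ℝ) ≠ 0 := by positivity
  have p2 : ((2:ℝ) ^ l * l.factorial) ≠ 0 := by positivity
  generalize (2:ℝ) ^ l * l.factorial = c at *
  generalize hD : ((2 * l).factorial : ℝ) = D at *
  push_cast [hD] at hB
  have h3 : c ^ 2 * legendreInner l l 0 = D * polyInt ((1 - X ^ 2) ^ l) := by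
    field_simp at h
    simp at h
    linear_combination -h
  have h4 : c ^ 2 * (legendreInner l l 0 * (2 * l + 1)) = c ^ 2 * 2 := by
    linear_combination (2 * l + 1 : ℝ) * h3 + hB
  rw [eq_div_iff (by positivity)]
  exact mul_left_cancel₀ (pow_ne_zero 2 p2) h4

theorem legendreInner_self {l m : ℕ} (hm : m ≤ l) :
    legendreInner l l m = 2 / (2 * l + 1) * ((l + m).factorial / (l - m).factorial) := by
  have h := legendreInner_eq_mul_zero l hm
  rw [legendreInner_self_zero] at h
  have p : ((l - m).factorial : ℝ) ≠ 0 := by positivity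
  field_simp at h ⊢
  linear_combination h

/-! ### Integrals of monomials over the sphere, by Gaussian integration. -/

/-- Polar coordinates for a positively homogeneous function times a radial one. -/
theorem integral_homogeneous_mul_radial {E : Type*} [NormedAddCommGroup E] [NormedSpace ℝ E]
    [MeasurableSpace E] [BorelSpace E] [FiniteDimensional ℝ E] [Nontrivial E] (μ : Measure E)
    [μ.IsAddHaarMeasure] (d : ℕ) (G : E → ℂ) (hG : ∀ (r : ℝ) (x : E), 0 < r → G (r • x) = r ^ d * G x)
    (g : ℝ → ℂ) :
    ∫ x, G x * g ‖x‖ ∂μ = (∫ x : Metric.sphere (0 : E) 1, G x ∂μ.toSphere) *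
      ∫ y in Set.Ioi (0 : ℝ), (y : ℂ) ^ (Module.finrank ℝ E - 1) * (y ^ d * g y) := by
  calc
    ∫ x, G x * g ‖x‖ ∂μ = ∫ x : ({(0)}ᶜ : Set E), G x * g ‖x.1‖ ∂(μ.comap (↑)) := by
      rw [integral_subtype_comap (measurableSet_singleton _).compl fun x ↦ G x * g ‖x‖,
        restrict_compl_singleton]
    _ = ∫ x, G x.1 * ((x.2 : ℂ) ^ d * g x.2)
          ∂μ.toSphere.prod (.volumeIoiPow (Module.finrank ℝ E - 1)) := by
      rw [← μ.measurePreserving_homeomorphUnitSphereProd.integral_comp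
        (Homeomorph.measurableEmbedding _)]
      refine integral_congr_ae (.of_forall fun x => ?_)
      have hx : 0 < ‖x.1‖ := norm_pos_iff.2 x.2
      have h := hG ‖x.1‖ (homeomorphUnitSphereProd E x).1 hx
      simp only [homeomorphUnitSphereProd_apply_fst_coe, homeomorphUnitSphereProd_apply_snd_coe]
        at h ⊢
      rw [smul_inv_smul₀ hx.ne'] at h
      rw [h]
      ring
    _ = (∫ x : Metric.sphere (0 : E) 1, G x ∂μ.toSphere) *
        ∫ x : Set.Ioi (0 : ℝ), ((x : ℂ) ^ d * g x) ∂.volumeIoiPow (Module.finrank ℝ E - 1) :=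
      integral_prod_mul (fun x : Metric.sphere (0 : E) 1 => G x)
        (fun x : Set.Ioi (0 : ℝ) => ((x : ℂ) ^ d * g x))
    _ = _ := by
      congr 1
      simp only [Measure.volumeIoiPow, ENNReal.ofReal]
      rw [integral_withDensity_eq_integral_smul,
        integral_subtype_comap measurableSet_Ioi fun a : ℝ ↦
          Real.toNNReal (a ^ (Module.finrank ℝ E - 1)) • ((a : ℂ) ^ d * g a),
        setIntegral_congr_fun measurableSet_Ioi fun x hx ↦ ?_]
      · rw [NNReal.smul_def, Real.coe_toNNReal _ (pow_nonneg hx.out.le _)]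
        simp
      · exact (measurable_subtype_coe.pow_const _).real_toNNReal

/-- The complex horizontal coordinate `x₀ + i x₁`. -/
def horiz (x : E3) : ℂ := ⟨x 0, x 1⟩

/-- Cylindrical coordinates `(x₂, x₀ + i x₁)` on three-dimensional space. -/
noncomputable def cylEquiv : E3 ≃ᵐ ℝ × ℂ :=
  (MeasurableEquiv.toLp 2 (Fin 3 → ℝ)).symm.trans
    ((MeasurableEquiv.piFinSuccAbove (fun _ : Fin 3 => ℝ) 2).trans
      ((MeasurableEquiv.refl ℝ).prodCongr Complex.measurableEquivPi.symm))

theorem cylEquiv_apply (x : E3) : cylEquiv x = (x 2, horiz x) := by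
  have h : MeasurableEquiv.piFinSuccAbove (fun _ : Fin 3 => ℝ) 2 x.ofLp = (x 2, ![x 0, x 1]) := by
    refine Prod.ext ?_ (funext fun i => ?_)
    · rfl
    · fin_cases i <;> rfl
  change (MeasurableEquiv.refl ℝ).prodCongr Complex.measurableEquivPi.symm
    (MeasurableEquiv.piFinSuccAbove (fun _ : Fin 3 => ℝ) 2 x.ofLp) = _
  rw [h]
  change Prod.mk (x 2) (Complex.measurableEquivPi.symm _) = _
  rw [Complex.measurableEquivPi_symm_apply]
  simp [horiz, Complex.mk_eq_add_mul_I]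

theorem measurePreserving_cylEquiv : MeasurePreserving cylEquiv volume volume := by
  have h1 := EuclideanSpace.volume_preserving_symm_measurableEquiv_toLp (Fin 3)
  have h2 := volume_preserving_piFinSuccAbove (fun _ : Fin 3 => ℝ) 2
  have h3 := (MeasurePreserving.id (volume : Measure ℝ)).prod
    (Complex.volume_preserving_equiv_pi.symm Complex.measurableEquivPi)
  exact h3.comp (h2.comp h1)

theorem norm_sq_cylindrical (x : E3) : ‖x‖ ^ 2 = x 2 ^ 2 + ‖horiz x‖ ^ 2 := by
  rw [EuclideanSpace.norm_sq_eq, Fin.sum_univ_three, ← Complex.normSq_eq_norm_sq, horiz,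
    Complex.normSq_mk]
  simp only [Real.norm_eq_abs, sq_abs]
  ring

/-- The Gaussian weight factors over the height and the horizontal plane, so Fubini applies. -/
theorem integral_gaussian_cylindrical (m k : ℕ) :
    ∫ x : E3, (horiz x ^ m * (x 2 : ℂ) ^ k) * (Real.exp (-‖x‖ ^ 2) : ℂ) =
      (∫ t : ℝ, (t : ℂ) ^ k * (Real.exp (-t ^ 2) : ℂ)) *
        ∫ w : ℂ, w ^ m * (Real.exp (-‖w‖ ^ 2) : ℂ) := by
  rw [← integral_prod_mul, ← Measure.volume_eq_prod,
    ← measurePreserving_cylEquiv.integral_comp cylEquiv.measurableEmbedding]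
  refine integral_congr_ae (.of_forall fun x => ?_)
  simp only [cylEquiv_apply]
  rw [norm_sq_cylindrical, neg_add, Real.exp_add]
  push_cast
  ring

/-- Rotation by the angle `π / m` preserves the weight and changes the sign of `w^m`. -/
theorem integral_complex_pow_mul_gaussian {m : ℕ} (hm : m ≠ 0) :
    ∫ w : ℂ, w ^ m * (Real.exp (-‖w‖ ^ 2) : ℂ) = 0 := by
  have h := (rotation (Circle.exp (Real.pi / m))).measurePreserving.integral_comp
    (rotation (Circle.exp (Real.pi / m))).toHomeomorph.measurableEmbedding
    (fun w : ℂ => w ^ m * (Real.exp (-‖w‖ ^ 2) : ℂ))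
  have e : ((Circle.exp (Real.pi / m) : Circle) : ℂ) ^ m = -1 := by
    rw [Circle.coe_exp, ← Complex.exp_nat_mul, ← Complex.exp_pi_mul_I]
    congr 1
    push_cast
    field_simp
  simp only [rotation_apply, mul_pow, e, norm_mul, Circle.norm_coe, one_mul, neg_mul, integral_neg] at h
  exact CharZero.neg_eq_self_iff.mp h

theorem integral_complex_gaussian : ∫ w : ℂ, (Real.exp (-‖w‖ ^ 2) : ℂ) = Real.pi := by
  have h := Complex.integral_exp_neg_rpow (p := 2) one_le_two
  rw [integral_complex_ofReal]
  norm_num at h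
  rw [h]

theorem integral_Ioi_pow_mul_gaussian (k : ℕ) :
    ∫ t in Set.Ioi (0 : ℝ), t ^ k * Real.exp (-t ^ 2) = 1 / 2 * Real.Gamma ((k + 1) / 2) := by
  rw [← integral_rpow_mul_exp_neg_rpow two_pos (by linarith [k.cast_nonneg (α := ℝ)])]
  simp

theorem integral_pow_mul_gaussian_of_even {k : ℕ} (hk : Even k) :
    ∫ t : ℝ, t ^ k * Real.exp (-t ^ 2) = Real.Gamma ((k + 1) / 2) := by
  have h := integral_comp_abs (f := fun t : ℝ => t ^ k * Real.exp (-t ^ 2))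
  simp only [hk.pow_abs, sq_abs] at h
  rw [h, integral_Ioi_pow_mul_gaussian]
  ring

theorem integral_pow_mul_gaussian_of_odd {k : ℕ} (hk : Odd k) :
    ∫ t : ℝ, t ^ k * Real.exp (-t ^ 2) = 0 := by
  have h := integral_neg_eq_self (fun t : ℝ => t ^ k * Real.exp (-t ^ 2)) volume
  simp only [hk.neg_pow, neg_sq, neg_mul, integral_neg] at h
  linarith

/-- One Gaussian integral is computed twice: polar coordinates give the left side, cylindrical ones
the right. The Gamma factor is the radial integral of `r^(m+k+2) exp(-r²)`, from homogeneity of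
degree `m + k` and the Jacobian `r²`. -/
theorem integral_sphere_monomial_mul (m k : ℕ) :
    (∫ x : S2, horiz x ^ m * ((x : E3) 2 : ℂ) ^ k ∂surfaceMeasure) *
      ((1 / 2 * Real.Gamma ((m + k + 3) / 2) : ℝ) : ℂ) =
      (∫ t : ℝ, (t : ℂ) ^ k * (Real.exp (-t ^ 2) : ℂ)) *
        ∫ w : ℂ, w ^ m * (Real.exp (-‖w‖ ^ 2) : ℂ) := by
  have h := integral_homogeneous_mul_radial (volume : Measure E3) (m + k)
    (fun x => horiz x ^ m * (x 2 : ℂ) ^ k) (fun r x _ => by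
      have : horiz (r • x) = r * horiz x := by
        apply Complex.ext <;> simp [horiz]
      simp [this]
      ring) (fun r => (Real.exp (-r ^ 2) : ℂ))
  rw [integral_gaussian_cylindrical, finrank_euclideanSpace_fin] at h
  rw [h, surfaceMeasure]
  congr 1
  have h2 := integral_Ioi_pow_mul_gaussian (m + k + 2)
  rw [show ((m + k + 3 : ℝ)) / 2 = (((m + k + 2 : ℕ) : ℝ) + 1) / 2 by push_cast; ring, ← h2,
    ← integral_complex_ofReal]
  congr 1
  ext y
  push_cast
  ring

theorem integral_sphere_horiz_pow_mul {m : ℕ} (hm : m ≠ 0) (k : ℕ) :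
    ∫ x : S2, horiz x ^ m * ((x : E3) 2 : ℂ) ^ k ∂surfaceMeasure = 0 := by
  have h := integral_sphere_monomial_mul m k
  rw [integral_complex_pow_mul_gaussian hm, mul_zero] at h
  refine (mul_eq_zero.1 h).resolve_right ?_
  have := Real.Gamma_pos_of_pos (s := (m + k + 3 : ℝ) / 2) (by positivity)
  exact_mod_cast (by positivity : (1 / 2 * Real.Gamma ((m + k + 3 : ℝ) / 2)) ≠ 0)

/-- The functional equation of Gamma cancels the transcendental factors and leaves `4π / (k + 1)`
for even `k`; for odd `k` the integral vanishes by parity. -/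
theorem integral_sphere_height_pow (k : ℕ) :
    ∫ x : S2, ((x : E3) 2 : ℂ) ^ k ∂surfaceMeasure =
      ((2 * Real.pi * polyInt (Polynomial.X ^ k) : ℝ) : ℂ) := by
  have h := integral_sphere_monomial_mul 0 k
  have h0 := Real.Gamma_pos_of_pos (s := ((k : ℝ) + 1) / 2) (by positivity)
  simp only [pow_zero, one_mul, integral_complex_gaussian] at h
  have e : Real.Gamma ((((0 : ℕ) : ℝ) + k + 3) / 2) = (k + 1) / 2 * Real.Gamma ((k + 1) / 2) := by
    rw [← Real.Gamma_add_one (by positivity)]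
    congr 1
    push_cast
    ring
  have hr : (∫ t : ℝ, (t : ℂ) ^ k * (Real.exp (-t ^ 2) : ℂ)) =
      ((∫ t : ℝ, t ^ k * Real.exp (-t ^ 2) : ℝ) : ℂ) := by
    rw [← integral_complex_ofReal]
    push_cast
    rfl
  rw [e, hr] at h
  have hne : ((1 / 2 * ((k + 1) / 2 * Real.Gamma ((k + 1) / 2)) : ℝ) : ℂ) ≠ 0 := by
    exact_mod_cast (by positivity)
  refine mul_right_cancel₀ hne (h.trans ?_)
  rw [polyInt_X_pow]
  rw [← Complex.ofReal_mul, ← Complex.ofReal_mul, Complex.ofReal_inj]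
  rcases Nat.even_or_odd k with hk | hk
  · rw [integral_pow_mul_gaussian_of_even hk, hk.add_one.neg_one_pow]
    field_simp
    ring
  · rw [integral_pow_mul_gaussian_of_odd hk, hk.add_one.neg_one_pow]
    simp

instance : IsFiniteMeasure surfaceMeasure := by
  unfold surfaceMeasure; infer_instance

@[fun_prop]
theorem continuous_horiz : Continuous fun x : S2 => horiz x := by
  have : (fun x : S2 => horiz x) = fun x : S2 => ((x : E3) 0 : ℂ) + ((x : E3) 1 : ℂ) * Complex.I := by
    ext x
    exact (Complex.mk_eq_add_mul_I _ _)
  rw [this]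
  fun_prop

theorem integrable_of_continuous {μ : Measure S2} [IsFiniteMeasure μ] {F : Type*}
    [NormedAddCommGroup F] [SecondCountableTopology F] [MeasurableSpace F] [BorelSpace F]
    {g : S2 → F} (hg : Continuous g) : Integrable g μ :=
  (BoundedContinuousFunction.mkOfCompact ⟨g, hg⟩).integrable μ

theorem integral_sphere_horiz_pow_mul_eval {m : ℕ} (hm : m ≠ 0) (p : Polynomial ℝ) :
    ∫ x : S2, horiz x ^ m * ((p.eval ((x : E3) 2) : ℝ) : ℂ) ∂surfaceMeasure = 0 := by
  induction p using Polynomial.induction_on' with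
  | add p q hp hq =>
    simp only [Polynomial.eval_add, Complex.ofReal_add, mul_add]
    rw [integral_add, hp, hq, add_zero] <;>
    exact integrable_of_continuous (by fun_prop)
  | monomial k a =>
    have h := integral_sphere_horiz_pow_mul hm k
    simp only [Polynomial.eval_monomial, Complex.ofReal_mul, Complex.ofReal_pow, mul_left_comm _ (a : ℂ)]
    rw [integral_const_mul, h, mul_zero]

/-- **Archimedes**: the height is uniformly distributed on the sphere. -/
theorem integral_sphere_eval_height (p : Polynomial ℝ) :
    ∫ x : S2, ((p.eval ((x : E3) 2) : ℝ) : ℂ) ∂surfaceMeasure = ((2 * Real.pi * polyInt p : ℝ) : ℂ) := by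
  induction p using Polynomial.induction_on' with
  | add p q hp hq =>
    simp only [Polynomial.eval_add, Complex.ofReal_add]
    rw [integral_add, hp, hq, map_add]
    · push_cast; ring
    all_goals exact integrable_of_continuous (by fun_prop)
  | monomial k a =>
    have h := integral_sphere_height_pow k
    simp only [Polynomial.eval_monomial, Complex.ofReal_mul, Complex.ofReal_pow]
    rw [integral_const_mul, h, ← Polynomial.C_mul_X_pow_eq_monomial, polyInt_C_mul]
    push_cast
    ring

/-! ### Spherical harmonics in Cartesian coordinates and their orthonormality. -/

theorem norm_horiz_sq (x : S2) : ‖horiz x‖ ^ 2 = 1 - (x : E3) 2 ^ 2 := by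
  have h := norm_sq_cylindrical x
  have hx : ‖(x : E3)‖ = 1 := by simp
  rw [hx] at h
  linarith

theorem horiz_mul_star (x : S2) : horiz x * star (horiz x) = ((1 - (x : E3) 2 ^ 2 : ℝ) : ℂ) := by
  rw [← norm_horiz_sq, Complex.star_def, Complex.mul_conj, Complex.normSq_eq_norm_sq]

theorem cos_colatitude (x : S2) : Real.cos (colatitude x) = (x : E3) 2 := by
  have h := norm_horiz_sq x
  have h2 : (x : E3) 2 ^ 2 ≤ 1 := by nlinarith [sq_nonneg ‖horiz x‖]
  exact Real.cos_arccos (abs_le.1 ((sq_le_one_iff_abs_le_one _).1 h2)).1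
    (abs_le.1 ((sq_le_one_iff_abs_le_one _).1 h2)).2

theorem sqrt_mul_exp_longitude (x : S2) :
    (√(1 - (x : E3) 2 ^ 2) : ℂ) * Complex.exp (longitude x * Complex.I) = horiz x := by
  rw [← norm_horiz_sq, Real.sqrt_sq (norm_nonneg _)]
  exact Complex.norm_mul_exp_arg_mul_I _

theorem sqrt_mul_exp_neg_longitude (x : S2) :
    (√(1 - (x : E3) 2 ^ 2) : ℂ) * Complex.exp (-(longitude x * Complex.I)) = star (horiz x) := by
  rw [← sqrt_mul_exp_longitude, star_mul', Complex.star_def, Complex.conj_ofReal,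
    ← Complex.exp_conj]
  simp

/-- The constant factor of `Y_l^m` in the coordinates `x₀ + i x₁` and `x₂`. -/
noncomputable def harmonicConst (l : ℕ) (m : ℤ) : ℝ :=
  (if 0 ≤ m then (-1) ^ m.natAbs else 1) *
    √((2 * (l : ℝ) + 1) / (4 * Real.pi) * ((l - m.natAbs).factorial / (l + m.natAbs).factorial))

/-- The function `w^a w̄^b p(x₂)` on the sphere, where `w = x₀ + i x₁`. -/
noncomputable def monomialFun (a b : ℕ) (p : Polynomial ℝ) (x : S2) : ℂ :=
  horiz x ^ a * star (horiz x) ^ b * ((p.eval ((x : E3) 2) : ℝ) : ℂ)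

@[fun_prop]
theorem continuous_monomialFun (a b : ℕ) (p : Polynomial ℝ) : Continuous (monomialFun a b p) := by
  unfold monomialFun
  have : Continuous fun x : S2 => star (horiz x) := continuous_star.comp continuous_horiz
  fun_prop

/-- Since `sin ϑ · e^{iφ} = x₀ + i x₁`, the angles disappear. This makes `Y_ℓ^m` visibly polynomial,
and continuous where the longitude is not. -/
theorem sphericalHarmonic_eq {l : ℕ} {m : ℤ} (hm : m.natAbs ≤ l) (x : S2) :
    sphericalHarmonic l m x = (harmonicConst l m : ℂ) *
      monomialFun m.toNat (-m).toNat (legendreDeriv l m.natAbs) x := by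
  rw [sphericalHarmonic, sphericalHarmonicAngles, cos_colatitude]
  rcases m with m | k
  · have e : Complex.exp (Complex.I * ((Int.ofNat m : ℤ) : ℂ) * (longitude x : ℂ)) =
        Complex.exp (longitude x * Complex.I) ^ m := by
      rw [← Complex.exp_nat_mul]
      congr 1
      rw [Int.ofNat_eq_natCast, Int.cast_natCast]
      ring
    have e1 : ((l : ℤ) - Int.ofNat m).toNat = l - m := by simp
    have e2 : ((l : ℤ) + Int.ofNat m).toNat = l + m := by simp; omega
    have e3 : (-Int.ofNat m).toNat = 0 := by simp
    have e4 : (Int.ofNat m).toNat = m := rfl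
    have e5 : (Int.ofNat m).natAbs = m := rfl
    have e6 : ((-1 : ℝ) ^ (Int.ofNat m)) = (-1) ^ m := zpow_natCast _ _
    have e7 : 0 ≤ Int.ofNat m := Int.natCast_nonneg m
    rw [e, e1, e2, e6, harmonicConst, monomialFun, e3, e4, e5, if_pos e7, assocLegendre,
      ← sqrt_mul_exp_longitude]
    push_cast
    ring
  · simp only [Int.natAbs_negSucc, Nat.succ_eq_add_one] at hm
    have e : Complex.exp (Complex.I * ((Int.negSucc k : ℤ) : ℂ) * (longitude x : ℂ)) =
        Complex.exp (-(longitude x * Complex.I)) ^ (k + 1) := by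
      rw [← Complex.exp_nat_mul]
      congr 1
      push_cast [Int.cast_negSucc]
      ring
    have e1 : ((l : ℤ) - Int.negSucc k).toNat = l + (k + 1) := by omega
    have e2 : ((l : ℤ) + Int.negSucc k).toNat = l - (k + 1) := by omega
    have e3 : (-Int.negSucc k).toNat = k + 1 := by omega
    have e4 : (Int.negSucc k).toNat = 0 := rfl
    have e5 : (Int.negSucc k).natAbs = k + 1 := rfl
    have e6 : ((-1 : ℝ) ^ (Int.negSucc k)) = (-1) ^ (k + 1) := by
      rw [zpow_negSucc, ← inv_pow]; norm_num
    have e7 : ¬ 0 ≤ Int.negSucc k := by omega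
    have p1 : (0 : ℝ) < (l - (k + 1)).factorial := by positivity
    have p2 : (0 : ℝ) < (l + (k + 1)).factorial := by positivity
    -- For negative order the factorial ratio under the root is inverted; the ratio in the
    -- definition of `P_ℓ^{-m}` inverts it back.
    have hs : √((2 * (l : ℝ) + 1) / (4 * Real.pi) *
        ((l + (k + 1)).factorial / (l - (k + 1)).factorial)) *
          ((l - (k + 1)).factorial / (l + (k + 1)).factorial) =
        √((2 * (l : ℝ) + 1) / (4 * Real.pi) *
          ((l - (k + 1)).factorial / (l + (k + 1)).factorial)) := by
      rw [← Real.sqrt_sq (by positivity :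
        (0 : ℝ) ≤ (l - (k + 1)).factorial / (l + (k + 1)).factorial), ← Real.sqrt_mul (by positivity),
        Real.sqrt_sq (by positivity)]
      congr 1
      field_simp
    rw [e, e1, e2, e6, harmonicConst, monomialFun, e3, e4, e5, if_neg e7, assocLegendre,
      ← sqrt_mul_exp_neg_longitude, ← hs]
    -- The signs from `Y_ℓ^m` and from `P_ℓ^{-m}` cancel, which is why `harmonicConst` is positive
    -- for negative orders.
    have hsign : ((-1 : ℂ) ^ (k + 1)) * (-1) ^ (k + 1) = 1 := by
      rw [← mul_pow]; norm_num
    push_cast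
    linear_combination (√((2 * (l : ℝ) + 1) / (4 * Real.pi) *
        ((l + (k + 1)).factorial / (l - (k + 1)).factorial)) *
          ((l - (k + 1)).factorial / (l + (k + 1)).factorial) *
        (√(1 - (x : E3) 2 ^ 2) * Complex.exp (-(longitude x * Complex.I))) ^ (k + 1) *
        (((legendreDeriv l (k + 1)).eval ((x : E3) 2) : ℝ) : ℂ)) * hsign

theorem harmonicConst_ne_zero (l : ℕ) (m : ℤ) : harmonicConst l m ≠ 0 := by
  unfold harmonicConst
  have := Real.pi_pos
  refine mul_ne_zero (by split_ifs <;> simp) (by positivity)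

theorem harmonicConst_sq (l : ℕ) (m : ℤ) : harmonicConst l m ^ 2 =
    (2 * (l : ℝ) + 1) / (4 * Real.pi) * ((l - m.natAbs).factorial / (l + m.natAbs).factorial) := by
  rw [harmonicConst, mul_pow, Real.sq_sqrt (by positivity)]
  split_ifs <;> simp [← pow_mul, mul_comm _ 2]

theorem harmonicConst_neg (l : ℕ) (m : ℤ) :
    harmonicConst l (-m) = (-1) ^ m.natAbs * harmonicConst l m := by
  have hsign : ((-1 : ℝ) ^ m.natAbs) * (-1) ^ m.natAbs = 1 := by
    rw [← mul_pow]; norm_num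
  rcases lt_trichotomy m 0 with h | rfl | h
  · simp [harmonicConst, h.le, h.not_ge]
  · simp
  · simp [harmonicConst, h.le, h.not_ge]
    rw [← mul_assoc, hsign, one_mul]

theorem star_monomialFun (a b : ℕ) (p : Polynomial ℝ) (x : S2) :
    star (monomialFun a b p x) = monomialFun b a p x := by
  simp [monomialFun, mul_comm]

theorem monomialFun_mul (a b c d : ℕ) (p q : Polynomial ℝ) (x : S2) :
    monomialFun a b p x * monomialFun c d q x = monomialFun (a + c) (b + d) (p * q) x := by
  simp [monomialFun, pow_add]
  ring

/-- On the sphere `w w̄ = 1 - x₂²`, so common powers of `w` and `w̄` can be absorbed into the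
polynomial in the height. -/
theorem monomialFun_add_add (a b c : ℕ) (p : Polynomial ℝ) (x : S2) :
    monomialFun (a + c) (b + c) p x = monomialFun a b ((1 - Polynomial.X ^ 2) ^ c * p) x := by
  have h : horiz x ^ c * star (horiz x) ^ c = (((1 - (x : E3) 2 ^ 2) ^ c : ℝ) : ℂ) := by
    rw [← mul_pow, horiz_mul_star]
    push_cast
    rfl
  simp only [monomialFun, pow_add, Polynomial.eval_mul, Complex.ofReal_mul, Polynomial.eval_pow,
    Polynomial.eval_sub, Polynomial.eval_one, Polynomial.eval_X, ← h]
  ring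

theorem sphericalHarmonic_neg {l : ℕ} {m : ℤ} (hm : m.natAbs ≤ l) (x : S2) :
    sphericalHarmonic l (-m) x = (-1) ^ m.natAbs * star (sphericalHarmonic l m x) := by
  rw [sphericalHarmonic_eq hm, sphericalHarmonic_eq (by rwa [Int.natAbs_neg]), harmonicConst_neg,
    star_mul', star_monomialFun, Int.natAbs_neg, neg_neg, Complex.star_def, Complex.conj_ofReal]
  push_cast
  ring

/-- Once the common powers are absorbed, a nonzero power of `w` or of `w̄` remains; conjugation
reduces the second case to the first. -/
theorem integral_monomialFun_of_ne {a b : ℕ} (hab : a ≠ b) (p : Polynomial ℝ) :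
    ∫ x, monomialFun a b p x ∂surfaceMeasure = 0 := by
  have key : ∀ c d : ℕ, d ≠ 0 → ∀ q, ∫ x, monomialFun (d + c) (0 + c) q x ∂surfaceMeasure = 0 := by
    intro c d hd q
    simp only [monomialFun_add_add]
    have h := integral_sphere_horiz_pow_mul_eval hd ((1 - Polynomial.X ^ 2) ^ c * q)
    simpa only [monomialFun, pow_zero, mul_one] using h
  rcases lt_or_gt_of_ne hab with h | h
  · have h2 := key a (b - a) (by omega) p
    rw [Nat.sub_add_cancel h.le, zero_add] at h2
    simp only [← star_monomialFun b a, Complex.star_def]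
    rw [integral_conj, h2, map_zero]
  · have h2 := key b (a - b) (by omega) p
    rwa [Nat.sub_add_cancel h.le, zero_add] at h2

theorem integral_monomialFun_self (a : ℕ) (p : Polynomial ℝ) :
    ∫ x, monomialFun a a p x ∂surfaceMeasure =
      ((2 * Real.pi * polyInt ((1 - Polynomial.X ^ 2) ^ a * p) : ℝ) : ℂ) := by
  rw [← integral_sphere_eval_height]
  have h := monomialFun_add_add 0 0 a p
  simp only [zero_add] at h
  simp only [h]
  simp [monomialFun]

theorem sphericalHarmonic_mul_star {l k : ℕ} {m n : ℤ} (hm : m.natAbs ≤ l) (hn : n.natAbs ≤ k)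
    (x : S2) : sphericalHarmonic l m x * star (sphericalHarmonic k n x) =
      ((harmonicConst l m * harmonicConst k n : ℝ) : ℂ) *
        monomialFun (m.toNat + (-n).toNat) ((-m).toNat + n.toNat)
          (legendreDeriv l m.natAbs * legendreDeriv k n.natAbs) x := by
  rw [sphericalHarmonic_eq hm, sphericalHarmonic_eq hn, star_mul', star_monomialFun,
    ← monomialFun_mul, Complex.star_def, Complex.conj_ofReal]
  push_cast
  ring

/-- The spherical harmonics are orthonormal. -/
theorem integral_sphericalHarmonic_mul_star {l k : ℕ} {m n : ℤ} (hm : m.natAbs ≤ l)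
    (hn : n.natAbs ≤ k) :
    ∫ x, sphericalHarmonic l m x * star (sphericalHarmonic k n x) ∂surfaceMeasure =
      if l = k ∧ m = n then 1 else 0 := by
  simp only [sphericalHarmonic_mul_star hm hn]
  rw [integral_const_mul]
  by_cases hmn : m = n
  · subst hmn
    -- Both exponents equal `|m|`, and `(w w̄)^|m|` supplies the weight of `legendreInner`.
    rw [show m.toNat + (-m).toNat = m.natAbs by omega,
      show (-m).toNat + m.toNat = m.natAbs by omega, integral_monomialFun_self, ← mul_assoc,
      ← legendreInner]
    by_cases hlk : l = k
    · subst hlk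
      rw [legendreInner_self hm, ← sq, harmonicConst_sq, if_pos ⟨rfl, rfl⟩]
      norm_cast
      have := Real.pi_pos
      field_simp
      norm_num
    · rw [legendreInner_of_ne hlk, if_neg (fun h => hlk h.1)]
      simp
  -- The exponents of `w` and `w̄` differ by `m - n ≠ 0`.
  · rw [integral_monomialFun_of_ne (by omega), mul_zero, if_neg (fun h => hmn h.2)]

/-! ### Completeness of the harmonics, and polynomial moments under the null hypothesis. -/

theorem span_legendreDeriv (m : ℕ) :
    Submodule.span ℝ (Set.range fun i : ℕ => legendreDeriv (m + i) m) = ⊤ := by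
  let S : Polynomial.Sequence ℝ :=
    { elems' := fun i => legendreDeriv (m + i) m
      degree_eq' := fun i => by rw [degree_legendreDeriv (by omega), Nat.add_sub_cancel_left] }
  refine S.span fun i => ?_
  rw [isUnit_iff_ne_zero, Polynomial.leadingCoeff_ne_zero]
  exact S.ne_zero i

/-- Every polynomial function on the sphere is a linear combination of spherical harmonics, so a
measure is determined on polynomials by its harmonic coefficients. -/
theorem integral_monomialFun_eq_of_harmonics {μ ν : Measure S2} [IsFiniteMeasure μ]
    [IsFiniteMeasure ν] {c : ℂ}
    (h : ∀ (l : ℕ) (m : ℤ), m.natAbs ≤ l →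
      ∫ x, sphericalHarmonic l m x ∂μ = c * ∫ x, sphericalHarmonic l m x ∂ν)
    (a b : ℕ) (p : Polynomial ℝ) :
    ∫ x, monomialFun a b p x ∂μ = c * ∫ x, monomialFun a b p x ∂ν := by
  -- For a pure power of `w` or `w̄`, expanding `p` in the `|m|`-th derivatives of the `P_ℓ`, `ℓ ≥
  -- |m|`, expresses the function through harmonics of order `m`.
  have key : ∀ (m : ℤ) (p : Polynomial ℝ), ∫ x, monomialFun m.toNat (-m).toNat p x ∂μ =
      c * ∫ x, monomialFun m.toNat (-m).toNat p x ∂ν := by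
    intro m p
    have hp : p ∈ Submodule.span ℝ (Set.range fun i : ℕ => legendreDeriv (m.natAbs + i) m.natAbs) := by
      rw [span_legendreDeriv]; trivial
    induction hp using Submodule.span_induction with
    | mem p hp =>
      obtain ⟨i, rfl⟩ := hp
      have hi : m.natAbs ≤ m.natAbs + i := by omega
      have h1 := h _ m hi
      simp only [sphericalHarmonic_eq hi, integral_const_mul] at h1
      have hc : (harmonicConst (m.natAbs + i) m : ℂ) ≠ 0 := by
        exact_mod_cast harmonicConst_ne_zero _ _
      refine mul_left_cancel₀ hc ?_
      rw [h1]
      ring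
    | zero => simp [monomialFun]
    | add p q _ _ hp hq =>
      have e : ∀ x, monomialFun m.toNat (-m).toNat (p + q) x = monomialFun m.toNat (-m).toNat p x +
          monomialFun m.toNat (-m).toNat q x := fun x => by simp [monomialFun, mul_add]
      simp only [e]
      rw [integral_add, integral_add, hp, hq, mul_add]
      all_goals exact integrable_of_continuous (by fun_prop)
    | smul r p _ hp =>
      have e : ∀ x, monomialFun m.toNat (-m).toNat (r • p) x =
          (r : ℂ) * monomialFun m.toNat (-m).toNat p x := fun x => by
        simp [monomialFun, mul_left_comm]
      simp only [e, integral_const_mul]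
      rw [hp]
      ring
  -- A general pair of exponents is a pure power times `(w w̄)^min(a, b)`.
  obtain ⟨m, d, rfl, rfl⟩ : ∃ (m : ℤ) (d : ℕ), a = m.toNat + d ∧ b = (-m).toNat + d :=
    ⟨(a : ℤ) - b, min a b, by omega, by omega⟩
  simp only [monomialFun_add_add]
  exact key _ _

theorem continuous_sphericalHarmonic {l : ℕ} {m : ℤ} (hm : m.natAbs ≤ l) :
    Continuous (sphericalHarmonic l m) := by
  rw [funext (sphericalHarmonic_eq hm)]
  fun_prop

theorem sphericalHarmonic_zero (x : S2) :
    sphericalHarmonic 0 0 x = (harmonicConst 0 0 : ℂ) := by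
  rw [sphericalHarmonic_eq (by simp)]
  simp [monomialFun, legendreDeriv, legendre]

/-- This is orthogonality to `Y_0^0`, a nonzero constant. -/
theorem integral_sphericalHarmonic_of_ne {l : ℕ} {m : ℤ} (hm : m.natAbs ≤ l) (hl : l ≠ 0) :
    ∫ x, sphericalHarmonic l m x ∂surfaceMeasure = 0 := by
  have h := integral_sphericalHarmonic_mul_star (k := 0) (n := 0) hm (by simp)
  rw [if_neg (fun h => hl h.1)] at h
  simp only [sphericalHarmonic_zero] at h
  rw [integral_mul_const] at h
  refine (mul_eq_zero.1 h).resolve_right ?_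
  simpa using harmonicConst_ne_zero 0 0

/-- Under the null hypothesis the polynomial moments are those of the uniform distribution. -/
theorem integral_monomialFun_of_nullHypothesis {f : S2 → ℝ} (hf_meas : Measurable f)
    (hf_nonneg : ∀ x, 0 ≤ f x)
    [IsProbabilityMeasure (surfaceMeasure.withDensity fun x => ENNReal.ofReal (f x))]
    (hH0 : NullHypothesis f) (a b : ℕ) (p : Polynomial ℝ) :
    ∫ x, monomialFun a b p x ∂(surfaceMeasure.withDensity fun x => ENNReal.ofReal (f x)) =
      (1 / (4 * Real.pi) : ℂ) * ∫ x, monomialFun a b p x ∂surfaceMeasure := by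
  refine integral_monomialFun_eq_of_harmonics (fun l m hm => ?_) a b p
  -- In degree 0 the harmonic is constant, and comparing total masses 1 and `4π` gives the factor `1
  -- / (4π)`. In the other degrees both integrals vanish.
  rcases eq_or_ne l 0 with rfl | hl
  · obtain rfl : m = 0 := by omega
    have h1 := integral_sphere_eval_height 1
    have h2 := polyInt_X_pow 0
    simp only [sphericalHarmonic_zero, integral_const, probReal_univ, one_smul]
    simp only [pow_zero, Polynomial.eval_one, Complex.ofReal_one, integral_const] at h1 h2
    norm_num [h2] at h1
    rw [Complex.real_smul, h1]
    have : (Real.pi : ℂ) ≠ 0 := by exact_mod_cast Real.pi_ne_zero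
    field_simp
    norm_num
  · rw [integral_sphericalHarmonic_of_ne hm hl, mul_zero]
    have h := hH0 l hl m (Finset.mem_Icc.2 (by omega))
    rw [harmonicCoeff] at h
    rw [integral_withDensity_eq_integral_toReal_smul (by fun_prop) (by simp)]
    -- The coefficients `a_ℓ^m` integrate the conjugate harmonic, so the integral is conjugated
    -- first.
    rw [← star_eq_zero, Complex.star_def, ← integral_conj, ← h]
    refine integral_congr_ae (.of_forall fun x => ?_)
    simp only [ENNReal.toReal_ofReal (hf_nonneg x), Complex.real_smul, map_mul, Complex.conj_ofReal,
      Complex.star_def]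

/-! ### The multivariate central limit theorem and the `χ²` limit of squared norms. -/

section CentralLimit

variable {Ω : Type*} [MeasurableSpace Ω] {P : Measure Ω}
  {E : Type*} [NormedAddCommGroup E] [InnerProductSpace ℝ E] [FiniteDimensional ℝ E]
  [MeasurableSpace E] [BorelSpace E]

open scoped RealInnerProductSpace in
-- This is the Cramér–Wold reduction: along a line, the characteristic function is that of a scalar
-- projection.
theorem charFun_map_eq_charFun_map_inner {Y : Ω → E} (hY : AEMeasurable Y P) (t : E) (r : ℝ) :
    charFun (P.map Y) (r • t) = charFun (P.map fun ω => ⟪Y ω, t⟫) r := by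
  rw [charFun_apply, charFun_apply_real, integral_map hY (by fun_prop),
    integral_map (by fun_prop) (by fun_prop)]
  simp only [inner_smul_right, Complex.ofReal_mul]

open scoped RealInnerProductSpace Topology in
/-- The central limit theorem in a finite-dimensional space, for summands with covariance the
identity. -/
theorem tendstoInDistribution_inv_sqrt_smul_sum [IsProbabilityMeasure P]
    {Z : ℕ → Ω → E} (hindep : iIndepFun Z P)
    (hident : ∀ i, IdentDistrib (Z i) (Z 0) P P) (h0 : ∀ t : E, ∫ ω, ⟪Z 0 ω, t⟫ ∂P = 0)
    (h1 : ∀ t : E, ∫ ω, ⟪Z 0 ω, t⟫ ^ 2 ∂P = ‖t‖ ^ 2) :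
    TendstoInDistribution (fun (n : ℕ) ω => (√n)⁻¹ • ∑ k ∈ Finset.range n, Z k ω) Filter.atTop
      (id : E → E) (fun _ => P) (stdGaussian E) where
  forall_aemeasurable n :=
    (Finset.aemeasurable_fun_sum _ fun k _ => (hident k).aemeasurable_fst).const_smul _
  tendsto := by
    refine ProbabilityMeasure.tendsto_iff_tendsto_charFun.2 fun t => ?_
    have hm k : AEMeasurable (Z k) P := (hident k).aemeasurable_fst
    have hS (n : ℕ) : AEMeasurable (fun ω => (√n)⁻¹ • ∑ k ∈ Finset.range n, Z k ω) P :=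
      (Finset.aemeasurable_fun_sum _ fun k _ => hm k).const_smul _
    simp only [ProbabilityMeasure.coe_mk, Measure.map_id, charFun_stdGaussian]
    rcases eq_or_ne t 0 with rfl | ht
    · have e (n : ℕ) : IsProbabilityMeasure
          (P.map fun ω => (√n)⁻¹ • ∑ k ∈ Finset.range n, Z k ω) :=
        Measure.isProbabilityMeasure_map (hS n)
      simp
    have ht' : ‖t‖ ≠ 0 := norm_ne_zero_iff.2 ht
    -- The projection on the unit vector `u` has variance 1, so the one-dimensional theorem applies
    -- at the argument `‖t‖`.
    let u : E := ‖t‖⁻¹ • t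
    have hu : ‖t‖ • u = t := smul_inv_smul₀ ht' t
    have hu1 : ‖u‖ = 1 := by simp [u, norm_smul, ht']
    have hind : iIndepFun (fun k ω => ⟪Z k ω, u⟫) P :=
      hindep.comp (fun _ z => ⟪z, u⟫) (fun _ => by fun_prop)
    have hid i : IdentDistrib (fun ω => ⟪Z i ω, u⟫) (fun ω => ⟪Z 0 ω, u⟫) P P :=
      (hident i).comp (u := fun z => ⟪z, u⟫) (by fun_prop)
    have hlim := tendsto_charFun_inv_sqrt_mul_pow (P := P) (X := fun ω => ⟪Z 0 ω, u⟫)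
      (hid 0).aemeasurable_fst (h0 u) (by simpa [hu1] using h1 u) ‖t‖
    rw [← Complex.ofReal_pow] at hlim ⊢
    refine hlim.congr fun n => ?_
    rw [← charFun_inv_sqrt_mul_sum hind hid]
    conv_rhs => rw [← hu, charFun_map_eq_charFun_map_inner (hS n)]
    simp only [real_inner_smul_left, sum_inner]

end CentralLimit

/-- The squared norm of a standard Gaussian vector has the `χ²` distribution. -/
theorem map_norm_sq_stdGaussian {E : Type*} [NormedAddCommGroup E] [InnerProductSpace ℝ E]
    [FiniteDimensional ℝ E] [MeasurableSpace E] [BorelSpace E] {d : ℕ}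
    (hd : Module.finrank ℝ E = d) :
    (stdGaussian E).map (fun z => ‖z‖ ^ 2) = chiSquared d := by
  subst hd
  rw [stdGaussian, Measure.map_map (by fun_prop) (by fun_prop), chiSquared]
  congr 1
  ext z
  simp only [Function.comp_apply]
  rw [← real_inner_self_eq_norm_sq, (stdOrthonormalBasis ℝ E).orthonormal.inner_sum]
  simp [sq]

/-- If `S n` converges in distribution to a standard Gaussian vector, then `‖S n‖²` converges to
the `χ²` distribution. -/
theorem tendstoInDistribution_norm_sq {Ω : Type*} [MeasurableSpace Ω] {P : Measure Ω}
    [IsProbabilityMeasure P] {E : Type*} [NormedAddCommGroup E] [InnerProductSpace ℝ E]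
    [FiniteDimensional ℝ E] [MeasurableSpace E] [BorelSpace E] {S : ℕ → Ω → E}
    (hS : TendstoInDistribution S Filter.atTop (id : E → E) (fun _ => P) (stdGaussian E)) {d : ℕ}
    (hd : Module.finrank ℝ E = d) :
    TendstoInDistribution (fun n ω => ‖S n ω‖ ^ 2) Filter.atTop (id : ℝ → ℝ) (fun _ => P)
      (chiSquared d) := by
  have h := hS.continuous_comp (g := fun z : E => ‖z‖ ^ 2) (by fun_prop)
  refine ⟨h.forall_aemeasurable, aemeasurable_id, ?_⟩
  have e : (stdGaussian E).map ((fun z : E => ‖z‖ ^ 2) ∘ id) = (chiSquared d).map id := by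
    rw [Function.comp_id, map_norm_sq_stdGaussian hd, Measure.map_id]
  have ht := h.tendsto
  convert! ht using 2
  exact congrArg nhds (Subtype.ext e.symm)

/-! ### The statistic as the squared norm of a normalized sum of real vectors. -/

theorem uniformityStatistic_eq_sum (L : ℕ) (x : ℕ → S2) (n : ℕ) :
    uniformityStatistic L x n = 4 * Real.pi * n *
      ∑ l ∈ Finset.Icc 1 L, ∑ m ∈ Finset.Icc (-(l : ℤ)) (l : ℤ), ‖estCoeff x n l m‖ ^ 2 := by
  rw [uniformityStatistic, EuclideanSpace.norm_sq_eq, Finset.sum_sigma']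
  change _ = 4 * Real.pi * n * ∑ p ∈ harmonicIndex L, ‖estCoeff x n p.1 p.2‖ ^ 2
  rw [← Finset.sum_coe_sort (harmonicIndex L)]
  rfl

/-- The real spherical harmonic `√(4π) (Re Y_l^m + Im Y_l^m)`. -/
noncomputable def casHarmonic (l : ℕ) (m : ℤ) (x : S2) : ℝ :=
  √(4 * Real.pi) * ((sphericalHarmonic l m x).re + (sphericalHarmonic l m x).im)

/-- Write `s m` for the sum of `Y_l^m` over the sample. Then `(Re s + Im s)² = |s|² + Im s²`, and `s
(-m) = (-1)^m` times the conjugate of `s m`, so the terms `Im s²` cancel between `m` and `-m`. One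
real function for each `m` thus suffices, with no case distinction on the sign of `m`. -/
theorem sum_estCoeff_norm_sq (l : ℕ) (x : ℕ → S2) (n : ℕ) :
    4 * Real.pi * n * ∑ m ∈ Finset.Icc (-(l : ℤ)) (l : ℤ), ‖estCoeff x n l m‖ ^ 2 =
      ∑ m ∈ Finset.Icc (-(l : ℤ)) (l : ℤ),
        ((√n)⁻¹ * ∑ k ∈ Finset.range n, casHarmonic l m (x k)) ^ 2 := by
  set s : ℤ → ℂ := fun m => ∑ k ∈ Finset.range n, sphericalHarmonic l m (x k) with hs
  have hcas (m : ℤ) : ∑ k ∈ Finset.range n, casHarmonic l m (x k) =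
      √(4 * Real.pi) * ((s m).re + (s m).im) := by
    simp only [casHarmonic, hs, ← Finset.mul_sum, Finset.sum_add_distrib, Complex.re_sum,
      Complex.im_sum]
  have hest (m : ℤ) : ‖estCoeff x n l m‖ ^ 2 = ((n : ℝ)⁻¹) ^ 2 * ‖s m‖ ^ 2 := by
    rw [estCoeff, ← star_sum, norm_mul, norm_star, mul_pow]
    simp [hs]
  have hsym : ∑ m ∈ Finset.Icc (-(l : ℤ)) (l : ℤ), (s m ^ 2).im = 0 := by
    have hneg : ∀ m ∈ Finset.Icc (-(l : ℤ)) (l : ℤ), (s (-m) ^ 2).im = -(s m ^ 2).im := by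
      intro m hm
      have hm' : m.natAbs ≤ l := by rw [Finset.mem_Icc] at hm; omega
      have e : s (-m) = (-1) ^ m.natAbs * star (s m) := by
        simp only [hs, sphericalHarmonic_neg hm', ← Finset.mul_sum, star_sum]
      rw [e, mul_pow, ← pow_mul, mul_comm _ 2, pow_mul, neg_one_sq, one_pow, one_mul, ← star_pow,
        Complex.star_def, Complex.conj_im]
    have h : ∑ m ∈ Finset.Icc (-(l : ℤ)) (l : ℤ), (s m ^ 2).im =
        ∑ m ∈ Finset.Icc (-(l : ℤ)) (l : ℤ), (s (-m) ^ 2).im :=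
      Finset.sum_nbij' (fun m => -m) (fun m => -m) (by simp; omega) (by simp; omega) (by simp)
        (by simp) (by simp)
    rw [Finset.sum_congr rfl hneg, Finset.sum_neg_distrib] at h
    linarith
  have hsq (m : ℤ) : ((s m).re + (s m).im) ^ 2 = ‖s m‖ ^ 2 + (s m ^ 2).im := by
    rw [← Complex.normSq_eq_norm_sq, Complex.normSq_apply, sq (s m), Complex.mul_im]
    ring
  simp only [hcas, hest, mul_pow, hsq, inv_pow, Real.sq_sqrt (Nat.cast_nonneg n),
    Real.sq_sqrt (by positivity : 0 ≤ 4 * Real.pi), ← Finset.mul_sum, Finset.sum_add_distrib, hsym]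
  rcases n.eq_zero_or_pos with rfl | hn
  · simp
  · field_simp
    ring

/-- The vector of the real spherical harmonics of degrees `1, …, L`. -/
noncomputable def casVector (L : ℕ) (x : S2) : EuclideanSpace ℝ (harmonicIndex L) :=
  WithLp.toLp 2 fun p => casHarmonic p.1.1 p.1.2 x

theorem uniformityStatistic_eq_norm_sq (L : ℕ) (x : ℕ → S2) (n : ℕ) :
    uniformityStatistic L x n = ‖(√n)⁻¹ • ∑ k ∈ Finset.range n, casVector L (x k)‖ ^ 2 := by
  rw [uniformityStatistic_eq_sum, Finset.mul_sum]
  simp only [sum_estCoeff_norm_sq]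
  rw [EuclideanSpace.norm_sq_eq, Finset.sum_sigma']
  change ∑ p ∈ harmonicIndex L, _ = _
  rw [← Finset.sum_coe_sort (harmonicIndex L)]
  refine Finset.sum_congr rfl fun p _ => ?_
  simp [casVector, mul_pow]

theorem natAbs_le_of_mem_harmonicIndex {L : ℕ} (p : harmonicIndex L) :
    p.1.2.natAbs ≤ p.1.1 ∧ p.1.1 ≠ 0 := by
  have h := p.2
  simp only [harmonicIndex, Finset.mem_sigma, Finset.mem_Icc] at h
  omega

theorem continuous_casHarmonic {l : ℕ} {m : ℤ} (hm : m.natAbs ≤ l) :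
    Continuous (casHarmonic l m) := by
  have h := continuous_sphericalHarmonic hm
  exact continuous_const.mul ((Complex.continuous_re.comp h).add (Complex.continuous_im.comp h))

theorem continuous_casVector (L : ℕ) : Continuous (casVector L) :=
  (PiLp.continuous_toLp 2 _).comp
    (continuous_pi fun p => continuous_casHarmonic (natAbs_le_of_mem_harmonicIndex p).1)

/-- Degree `ℓ` contributes `2ℓ + 1` orders; leaving out `ℓ = 0` makes the total `(L + 1)² - 1`. -/
theorem card_harmonicIndex (L : ℕ) : (harmonicIndex L).card = L * (L + 2) := by
  rw [harmonicIndex, Finset.card_sigma]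
  simp only [Int.card_Icc]
  induction L with
  | zero => simp
  | succ L ih =>
    rw [Finset.sum_Icc_succ_top (by omega), ih]
    have : ((L + 1 : ℕ) : ℤ) + 1 - -((L + 1 : ℕ) : ℤ) = ((2 * L + 3 : ℕ) : ℤ) := by push_cast; ring
    rw [this, Int.toNat_natCast]
    ring

/-! ### Means and covariances of the real harmonics under the null hypothesis. -/

section Moments

variable {f : S2 → ℝ} (hf_meas : Measurable f) (hf_nonneg : ∀ x, 0 ≤ f x)
  [IsProbabilityMeasure (surfaceMeasure.withDensity fun x => ENNReal.ofReal (f x))]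
  (hH0 : NullHypothesis f)

include hf_meas hf_nonneg hH0

theorem integral_sphericalHarmonic_of_nullHypothesis {l : ℕ} {m : ℤ} (hm : m.natAbs ≤ l)
    (hl : l ≠ 0) :
    ∫ x, sphericalHarmonic l m x ∂(surfaceMeasure.withDensity fun x => ENNReal.ofReal (f x)) = 0 := by
  have h := integral_sphericalHarmonic_of_ne hm hl
  simp only [sphericalHarmonic_eq hm, integral_const_mul] at h ⊢
  rw [integral_monomialFun_of_nullHypothesis hf_meas hf_nonneg hH0, mul_left_comm, h, mul_zero]

/-- A product of two harmonics is again polynomial on the sphere, so second moments are also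
uniform. It can involve degrees above `l` and `k`, so the null hypothesis enters through higher
degrees too. -/
theorem integral_mul_star_of_nullHypothesis {l k : ℕ} {m n : ℤ} (hm : m.natAbs ≤ l)
    (hn : n.natAbs ≤ k) :
    ∫ x, sphericalHarmonic l m x * star (sphericalHarmonic k n x)
      ∂(surfaceMeasure.withDensity fun x => ENNReal.ofReal (f x)) =
      (((if l = k ∧ m = n then 1 else 0) / (4 * Real.pi) : ℝ) : ℂ) := by
  have h := integral_sphericalHarmonic_mul_star hm hn
  simp only [sphericalHarmonic_mul_star hm hn, integral_const_mul] at h ⊢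
  rw [integral_monomialFun_of_nullHypothesis hf_meas hf_nonneg hH0, mul_left_comm, h]
  split_ifs <;> simp

theorem integral_casHarmonic {l : ℕ} {m : ℤ} (hm : m.natAbs ≤ l) (hl : l ≠ 0) :
    ∫ x, casHarmonic l m x ∂(surfaceMeasure.withDensity fun x => ENNReal.ofReal (f x)) = 0 := by
  have h := integral_sphericalHarmonic_of_nullHypothesis hf_meas hf_nonneg hH0 hm hl
  have hc := continuous_sphericalHarmonic hm
  have hi : Integrable (sphericalHarmonic l m)
    (surfaceMeasure.withDensity fun x => ENNReal.ofReal (f x)) := integrable_of_continuous hc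
  simp only [casHarmonic, integral_const_mul]
  have hre : Integrable (fun x => (sphericalHarmonic l m x).re)
    (surfaceMeasure.withDensity fun x => ENNReal.ofReal (f x)) := hi.re
  have him : Integrable (fun x => (sphericalHarmonic l m x).im)
    (surfaceMeasure.withDensity fun x => ENNReal.ofReal (f x)) := hi.im
  rw [integral_add hre him]
  have h1 := integral_re hi
  have h2 := integral_im hi
  simp only [RCLike.re_eq_complex_re, RCLike.im_eq_complex_im, h, Complex.zero_re,
    Complex.zero_im] at h1 h2 ⊢
  rw [h1, h2]
  simp

/-- With `Y = Y_l^m` and `Z = Y_k^n`, the product is `4π (Re (Y Z̄) + Im (Y Z))`. The first part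
integrates to the Kronecker delta. For the second, `Z` is up to sign the conjugate of `Y_k^{-n}`, so
`Y Z` has a real integral and contributes nothing. -/
theorem integral_casHarmonic_mul {l k : ℕ} {m n : ℤ} (hm : m.natAbs ≤ l) (hn : n.natAbs ≤ k) :
    ∫ x, casHarmonic l m x * casHarmonic k n x
      ∂(surfaceMeasure.withDensity fun x => ENNReal.ofReal (f x)) =
      if l = k ∧ m = n then 1 else 0 := by
  set μ := surfaceMeasure.withDensity fun x => ENNReal.ofReal (f x)
  have hcm := continuous_sphericalHarmonic hm
  have hcn := continuous_sphericalHarmonic hn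
  have hn' : (-n).natAbs ≤ k := by omega
  have hsm : Continuous fun x => star (sphericalHarmonic k n x) := continuous_star.comp hcn
  have hi1 : Integrable (fun x => sphericalHarmonic l m x * star (sphericalHarmonic k n x)) μ :=
    integrable_of_continuous (by fun_prop)
  have hi2 : Integrable (fun x => sphericalHarmonic l m x * sphericalHarmonic k n x) μ :=
    integrable_of_continuous (by fun_prop)
  have h1 := integral_mul_star_of_nullHypothesis hf_meas hf_nonneg hH0 hm hn
  have h2 := integral_mul_star_of_nullHypothesis hf_meas hf_nonneg hH0 hm hn'
  simp only [sphericalHarmonic_neg hn, star_mul', star_star, star_pow, star_neg, star_one,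
    mul_left_comm _ ((-1 : ℂ) ^ n.natAbs)] at h2
  rw [integral_const_mul] at h2
  have h3 : (∫ x, sphericalHarmonic l m x * sphericalHarmonic k n x ∂μ).im = 0 := by
    have hsign : ((-1 : ℂ) ^ n.natAbs) * (-1) ^ n.natAbs = 1 := by
      rw [← mul_pow]; norm_num
    have h4 := congrArg (fun z => (((-1 : ℝ) ^ n.natAbs : ℝ) : ℂ) * z) h2
    rw [← Complex.ofReal_mul, Complex.ofReal_pow, Complex.ofReal_neg, Complex.ofReal_one,
      ← mul_assoc, hsign, one_mul] at h4
    rw [h4, Complex.ofReal_im]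
  have e (x : S2) : casHarmonic l m x * casHarmonic k n x = 4 * Real.pi *
      ((sphericalHarmonic l m x * star (sphericalHarmonic k n x)).re +
        (sphericalHarmonic l m x * sphericalHarmonic k n x).im) := by
    have hs := Real.mul_self_sqrt (by positivity : 0 ≤ 4 * Real.pi)
    simp only [casHarmonic, Complex.mul_re, Complex.mul_im, Complex.star_def, Complex.conj_re,
      Complex.conj_im]
    linear_combination ((sphericalHarmonic l m x).re + (sphericalHarmonic l m x).im) *
      ((sphericalHarmonic k n x).re + (sphericalHarmonic k n x).im) * hs
  simp only [e, integral_const_mul]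
  have h5 := integral_re hi1
  have h6 := integral_im hi2
  simp only [RCLike.re_eq_complex_re, RCLike.im_eq_complex_im] at h5 h6
  have hre : Integrable
    (fun x => (sphericalHarmonic l m x * star (sphericalHarmonic k n x)).re) μ := hi1.re
  have him : Integrable (fun x => (sphericalHarmonic l m x * sphericalHarmonic k n x).im) μ :=
    hi2.im
  rw [integral_add hre him, h5, h6, h1, h3, Complex.ofReal_re, add_zero, mul_div_cancel₀ _ (by positivity)]

open scoped RealInnerProductSpace in
theorem integral_inner_casVector (L : ℕ) (t : EuclideanSpace ℝ (harmonicIndex L)) :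
    ∫ x, ⟪casVector L x, t⟫ ∂(surfaceMeasure.withDensity fun x => ENNReal.ofReal (f x)) = 0 := by
  simp only [PiLp.inner_apply, casVector, RCLike.inner_apply, conj_trivial]
  rw [integral_finsetSum]
  · refine Finset.sum_eq_zero fun p _ => ?_
    rw [integral_const_mul, integral_casHarmonic hf_meas hf_nonneg hH0
      (natAbs_le_of_mem_harmonicIndex p).1 (natAbs_le_of_mem_harmonicIndex p).2, mul_zero]
  · intro p _
    have := continuous_casHarmonic (natAbs_le_of_mem_harmonicIndex p).1
    exact integrable_of_continuous (by fun_prop)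

open scoped RealInnerProductSpace in
theorem integral_inner_casVector_sq (L : ℕ) (t : EuclideanSpace ℝ (harmonicIndex L)) :
    ∫ x, ⟪casVector L x, t⟫ ^ 2 ∂(surfaceMeasure.withDensity fun x => ENNReal.ofReal (f x)) =
      ‖t‖ ^ 2 := by
  have hc (p : harmonicIndex L) := continuous_casHarmonic (natAbs_le_of_mem_harmonicIndex p).1
  have e (p q : harmonicIndex L) (x : S2) : t p * casHarmonic p.1.1 p.1.2 x *
      (t q * casHarmonic q.1.1 q.1.2 x) =
        t p * t q * (casHarmonic p.1.1 p.1.2 x * casHarmonic q.1.1 q.1.2 x) := by ring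
  simp only [PiLp.inner_apply, casVector, RCLike.inner_apply, conj_trivial, sq, Finset.sum_mul_sum]
  rw [integral_finsetSum _ fun p _ => integrable_of_continuous (by fun_prop), ← sq,
    EuclideanSpace.norm_sq_eq]
  refine Finset.sum_congr rfl fun p _ => ?_
  rw [integral_finsetSum _ fun p _ => integrable_of_continuous (by fun_prop),
    Finset.sum_eq_single p]
  · simp only [e, integral_const_mul]
    rw [integral_casHarmonic_mul hf_meas hf_nonneg hH0 (natAbs_le_of_mem_harmonicIndex p).1
      (natAbs_le_of_mem_harmonicIndex p).1]
    simp [sq]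
  · intro q _ hq
    simp only [e, integral_const_mul]
    rw [integral_casHarmonic_mul hf_meas hf_nonneg hH0 (natAbs_le_of_mem_harmonicIndex p).1
      (natAbs_le_of_mem_harmonicIndex q).1, if_neg, mul_zero]
    rintro ⟨h1, h2⟩
    exact hq (Subtype.ext (Sigma.ext h1.symm (heq_of_eq h2.symm)))
  · simp

end Moments

/-! ### The case `L = 1`: the Rayleigh statistic. -/

/-- The harmonics of degree 1 are multiples of `x₂`, `w` and `w̄`. The squared constants are `3 /
(4π)` for order 0 and `3 / (8π)` for each of the orders `±1`; the latter two add up, so all three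
coordinates get the same weight. -/
theorem uniformityStatistic_one (x : ℕ → S2) (n : ℕ) :
    uniformityStatistic 1 x n = rayleighStatistic x n := by
  have hpi := Real.pi_pos
  set w : ℂ := ∑ k ∈ Finset.range n, horiz (x k) with hw
  set z : ℝ := ∑ k ∈ Finset.range n, (x k : E3) 2 with hz
  have hP0 : legendreDeriv 1 0 = Polynomial.X := by
    simp only [legendreDeriv, legendre, pow_one, Function.iterate_one, Function.iterate_zero_apply,
      Polynomial.derivative_sub, Polynomial.derivative_X_sq, Polynomial.derivative_one, sub_zero,
      ← mul_assoc, ← Polynomial.C_mul]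
    norm_num
  have hP1 : legendreDeriv 1 1 = 1 := by
    rw [legendreDeriv_succ, hP0, Polynomial.derivative_X]
  have hY0 (y : S2) : sphericalHarmonic 1 0 y = (harmonicConst 1 0 : ℂ) * ((y : E3) 2 : ℂ) := by
    rw [sphericalHarmonic_eq (by simp)]
    simp [monomialFun, hP0]
  have hY1 (y : S2) : sphericalHarmonic 1 1 y = (harmonicConst 1 1 : ℂ) * horiz y := by
    rw [sphericalHarmonic_eq (by simp)]
    simp [monomialFun, hP1]
  have hYneg (y : S2) : sphericalHarmonic 1 (-1) y = - star (sphericalHarmonic 1 1 y) := by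
    rw [sphericalHarmonic_neg (by simp)]
    simp
  have c0 := harmonicConst_sq 1 0
  have c1 := harmonicConst_sq 1 1
  norm_num at c0 c1
  have n0 : ‖estCoeff x n 1 0‖ ^ 2 = ((n : ℝ)⁻¹) ^ 2 * (harmonicConst 1 0 ^ 2 * z ^ 2) := by
    rw [estCoeff, ← star_sum, norm_mul, norm_star, mul_pow]
    simp only [hY0, ← Finset.mul_sum, ← Complex.ofReal_sum, ← hz, norm_mul, Complex.norm_real,
      mul_pow, Real.norm_eq_abs, sq_abs]
    simp
  have n1 : ‖estCoeff x n 1 1‖ ^ 2 = ((n : ℝ)⁻¹) ^ 2 * (harmonicConst 1 1 ^ 2 * ‖w‖ ^ 2) := by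
    rw [estCoeff, ← star_sum, norm_mul, norm_star, mul_pow]
    simp only [hY1, ← Finset.mul_sum, ← hw, norm_mul, Complex.norm_real, mul_pow,
      Real.norm_eq_abs, sq_abs]
    simp
  have n2 : ‖estCoeff x n 1 (-1)‖ ^ 2 = ‖estCoeff x n 1 1‖ ^ 2 := by
    simp only [estCoeff, hYneg, star_neg, star_star, Finset.sum_neg_distrib, mul_neg, norm_neg,
      norm_mul]
    rw [← star_sum, norm_star]
  have hR : ‖∑ k ∈ Finset.range n, (x k : E3)‖ ^ 2 = z ^ 2 + ‖w‖ ^ 2 := by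
    rw [norm_sq_cylindrical]
    have : horiz (∑ k ∈ Finset.range n, (x k : E3)) = w := by
      apply Complex.ext <;> simp [horiz, hw]
    rw [this]
    simp [hz]
  have hI : Finset.Icc (-((1 : ℕ) : ℤ)) ((1 : ℕ) : ℤ) = {-1, 0, 1} := by decide
  rw [uniformityStatistic_eq_sum, rayleighStatistic, norm_smul, mul_pow, hR, Finset.Icc_self,
    Finset.sum_singleton, hI, Finset.sum_insert (by decide), Finset.sum_insert (by decide),
    Finset.sum_singleton, n2, n0, n1, c0, c1]
  simp only [one_div, RCLike.norm_natCast, norm_inv]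
  field_simp
  ring

end SphericalUniformity

/-! ### The theorem. -/

theorem mainTheorem2
    {Ω : Type*} [MeasurableSpace Ω] (P : Measure Ω) [IsProbabilityMeasure P]
    (f : SphericalUniformity.S2 → ℝ) (hf_meas : Measurable f) (hf_nonneg : ∀ x, 0 ≤ f x)
    (X : ℕ → Ω → SphericalUniformity.S2)
    (hX_law : ∀ k, HasLaw (X k)
      (SphericalUniformity.surfaceMeasure.withDensity fun x => ENNReal.ofReal (f x)) P)
    (hX_indep : iIndepFun X P)
    (hH0 : SphericalUniformity.NullHypothesis f) :
    (∀ L : ℕ, 1 ≤ L →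
      (∀ n ω, SphericalUniformity.uniformityStatistic L (fun k => X k ω) n =
        4 * Real.pi * n * ∑ l ∈ Finset.Icc 1 L, ∑ m ∈ Finset.Icc (-(l : ℤ)) (l : ℤ),
          ‖SphericalUniformity.estCoeff (fun k => X k ω) n l m‖ ^ 2) ∧
      TendstoInDistribution
        (fun (n : ℕ) ω => SphericalUniformity.uniformityStatistic L (fun k => X k ω) n)
        Filter.atTop (id : ℝ → ℝ) (fun _ => P) (SphericalUniformity.chiSquared (L * (L + 2)))) ∧
    (∀ n ω, SphericalUniformity.uniformityStatistic 1 (fun k => X k ω) n =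
      SphericalUniformity.rayleighStatistic (fun k => X k ω) n) := by
  open SphericalUniformity in
  refine ⟨fun L _ => ⟨fun n ω => uniformityStatistic_eq_sum L _ n, ?_⟩,
    fun n ω => uniformityStatistic_one _ n⟩
  -- That `f` has total mass 1 follows from its being the density of the law of an observation.
  have : IsProbabilityMeasure
      (surfaceMeasure.withDensity fun x => ENNReal.ofReal (f x)) := by
    rw [← (hX_law 0).map_eq]
    exact Measure.isProbabilityMeasure_map (hX_law 0).aemeasurable
  have hc := continuous_casVector L
  have hlaw {g : S2 → ℝ} (hg : Continuous g) : ∫ ω, g (X 0 ω) ∂P =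
      ∫ x, g x ∂(surfaceMeasure.withDensity fun x => ENNReal.ofReal (f x)) := by
    rw [← (hX_law 0).map_eq, integral_map (hX_law 0).aemeasurable hg.aestronglyMeasurable]
  simp only [uniformityStatistic_eq_norm_sq]
  -- The goals left are independence, identical distribution, mean zero, identity covariance and the
  -- dimension count for `casVector L (X k)`.
  refine tendstoInDistribution_norm_sq (tendstoInDistribution_inv_sqrt_smul_sum
    (Z := fun k ω => casVector L (X k ω)) ?_ (fun i => ?_) (fun t => ?_) (fun t => ?_)) ?_
  · exact hX_indep.comp (fun _ => casVector L) (fun _ => hc.measurable)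
  · exact IdentDistrib.comp (u := casVector L) ⟨(hX_law i).aemeasurable, (hX_law 0).aemeasurable,
      by rw [(hX_law i).map_eq, (hX_law 0).map_eq]⟩ hc.measurable
  · rw [hlaw (g := fun x => inner ℝ (casVector L x) t) (by fun_prop),
      integral_inner_casVector hf_meas hf_nonneg hH0]
  · rw [hlaw (g := fun x => inner ℝ (casVector L x) t ^ 2) (by fun_prop),
      integral_inner_casVector_sq hf_meas hf_nonneg hH0]
  · rw [finrank_euclideanSpace, Fintype.card_coe, card_harmonicIndex]
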